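/- For $n,m,l\ge 1$ let $\bar x\in\{0,1\}^n$, $\bar y\in\{0,1\}^m$, $\bar z\in\{0,1\}^l$ and let $\bar{\mathcal W}=\bar x\otimes\bar y\otimes\bar z$ be the tensor with entries $\bar w_{ijk}=\bar x_i\bar y_j\bar z_k$ (the ground truth). Let $r_{\bar x}$ (resp. $r_{\bar y}$, $r_{\bar z}$) be the ratio of the number of ones in $\bar x$ (resp. $\bar y$, $\bar z$) to its length. In the semi-random corruption model with parameter $p\in[0,1]$, a random binary tensor is first obtained from $\bar{\mathcal W}$ by corrupting each entry (replacing $\bar w_{ijk}$ by $1-\bar w_{ijk}$) independently with probability $p$; an adversary then applies an arbitrary sequence of changes, each of which turns a corrupted entry back into the corresponding entry of $\bar{\mathcal W}$. The choice of the sequence may depend arbitrarily on $\bar{\mathcal W}$, on the random tensor, and on additional randomness. Let $\mathcal G=(g_{ijk})$ be the resulting tensor and let $S_0=\{(i,j,k): g_{ijk}=0\}$, $S_1=\{(i,j,k): g_{ijk}=1\}$. The standard LP with input $\mathcal G$ is $$ \begin{aligned} \min_{x,y,z,w}\quad & \sum_{(i,j,k)\in S_0} w_{ijk}+\sum_{(i,j,k)\in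 S_1}(1-w_{ijk})\\ \text{s.t.}\quad & w_{ijk}\le x_i,\quad w_{ijk}\le y_j,\quad w_{ijk}\le z_k && \forall (i,j,k)\in S_1,\\ & w_{ijk}\ge 0,\quad w_{ijk}\ge x_i+y_j+z_k-2 && \forall (i,j,k)\in S_0,\\ & (x,y,z)\in[0,1]^{n+m+l}. \end{aligned} $$ It recovers the ground truth if $(\bar x,\bar y,\bar z,\bar{\mathcal W})$ is its unique optimal solution. Suppose that $r_{\bar x}, r_{\bar y}, r_{\bar z}$ are positive constants (not depending on $n,m,l$) with $r_{\bar x}=r_{\bar y}=r_{\bar z}$, and let $r_{\bar w}:=r_{\bar x}r_{\bar y}r_{\bar z}$. Let $n,m,l\to\infty$ in such a way that each of $n e^{-m}$, $n e^{-l}$, $m e^{-n}$, $m e^{-l}$, $l e^{-n}$, $l e^{-m}$ tends to $0$. If $p\ge 0$ is a constant with $$p<\frac{r_{\bar w}}{2(1+r_{\bar w})},$$ then, for every choice of such ground truths and every adversary, the probability that the standard LP recovers the ground truth tends to $1$. -/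

import Mathlib

open Filter Topology MeasureTheory ProbabilityTheory

/-- Binary tensors of order three and size `n × m × l`. -/
abbrev BTensor (n m l : ℕ) : Type := Fin n × Fin m × Fin l → Bool

/-- The number `0` or `1` that a Boolean stands for. -/
def bit01 (b : Bool) : ℝ := if b then 1 else 0

/-- The outer product `x ⊗ y ⊗ z` of three binary vectors, with entries `x i * y j * z k`. -/
def outerProd {n m l : ℕ} (x : Fin n → Bool) (y : Fin m → Bool) (z : Fin l → Bool) :
    BTensor n m l :=
  fun e => x e.1 && y e.2.1 && z e.2.2

/-- The ratio of ones in a binary vector to its number of elements. -/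
noncomputable def density {n : ℕ} (x : Fin n → Bool) : ℝ :=
  ((Finset.univ.filter fun i => x i = true).card : ℝ) / (n : ℝ)

/-- Fully-random corruption model: the entries of the random tensor `G` are independent, and each
entry is corrupted (it differs from the entry of the ground truth `W`) with probability `p`. -/
structure IsFullyRandom {n m l : ℕ} {Ω : Type*} [MeasurableSpace Ω] (P : Measure Ω)
    (W : BTensor n m l) (p : ℝ) (G : Ω → BTensor n m l) : Prop where
  measurable : Measurable G
  indep : iIndepFun (fun (e : Fin n × Fin m × Fin l) (ω : Ω) => G ω e) P
  corrupted : ∀ e, P {ω | G ω e = !(W e)} = ENNReal.ofReal p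

/-- One monotone transformation with respect to the ground truth `W`: an entry that is `1` in `W`
and `0` in `G` is reverted to `1`, or an entry that is `0` in `W` and `1` in `G` is reverted
to `0`. -/
inductive MonotoneStep {n m l : ℕ} (W G : BTensor n m l) : BTensor n m l → Prop
  | revertToOne (e : Fin n × Fin m × Fin l) (hW : W e = true) (hG : G e = false) :
      MonotoneStep W G (Function.update G e true)
  | revertToZero (e : Fin n × Fin m × Fin l) (hW : W e = false) (hG : G e = true) :
      MonotoneStep W G (Function.update G e false)

/-- Semi-random corruption model: `G` arises from a fully-random corruption `G₀` of `W` when an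
adversary applies an arbitrary sequence of monotone transformations. The sequence may depend
in any way on the outcome (hence on the whole of `G₀`, on `W`, and on further randomness). -/
def IsSemiRandom {n m l : ℕ} {Ω : Type*} [MeasurableSpace Ω] (P : Measure Ω)
    (W : BTensor n m l) (p : ℝ) (G : Ω → BTensor n m l) : Prop :=
  Measurable G ∧ ∃ G₀ : Ω → BTensor n m l, IsFullyRandom P W p G₀ ∧
    ∀ ω, Relation.ReflTransGen (MonotoneStep W) (G₀ ω) (G ω)

/-- The variables `(x, y, z, w)` of the linear program. -/
@[ext]
structure LPPoint (n m l : ℕ) where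
  x : Fin n → ℝ
  y : Fin m → ℝ
  z : Fin l → ℝ
  w : Fin n × Fin m × Fin l → ℝ

/-- The constraints of the standard LP with input tensor `G`. -/
structure SLPFeasible {n m l : ℕ} (G : BTensor n m l) (s : LPPoint n m l) : Prop where
  le_x : ∀ i j k, G (i, j, k) = true → s.w (i, j, k) ≤ s.x i
  le_y : ∀ i j k, G (i, j, k) = true → s.w (i, j, k) ≤ s.y j
  le_z : ∀ i j k, G (i, j, k) = true → s.w (i, j, k) ≤ s.z k
  nonneg : ∀ i j k, G (i, j, k) = false → 0 ≤ s.w (i, j, k)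
  sum_le : ∀ i j k, G (i, j, k) = false → s.x i + s.y j + s.z k - 2 ≤ s.w (i, j, k)
  mem_x : ∀ i, s.x i ∈ Set.Icc (0 : ℝ) 1
  mem_y : ∀ j, s.y j ∈ Set.Icc (0 : ℝ) 1
  mem_z : ∀ k, s.z k ∈ Set.Icc (0 : ℝ) 1

/-- The objective function of the standard LP: the sum of `w` over the entries with `G = 0` plus
the sum of `1 - w` over the entries with `G = 1`. -/
noncomputable def slpObjective {n m l : ℕ} (G : BTensor n m l) (s : LPPoint n m l) : ℝ :=
  (∑ e with G e = false, s.w e) + ∑ e with G e = true, (1 - s.w e)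

/-- `s` is an optimal solution of the standard LP with input tensor `G`. -/
def SLPOptimal {n m l : ℕ} (G : BTensor n m l) (s : LPPoint n m l) : Prop :=
  SLPFeasible G s ∧ ∀ s', SLPFeasible G s' → slpObjective G s ≤ slpObjective G s'

/-- The point `(x, y, z, x ⊗ y ⊗ z)` given by three binary vectors. -/
noncomputable def truthPoint {n m l : ℕ} (x : Fin n → Bool) (y : Fin m → Bool)
    (z : Fin l → Bool) : LPPoint n m l where
  x := fun i => bit01 (x i)
  y := fun j => bit01 (y j)
  z := fun k => bit01 (z k)
  w := fun e => bit01 (outerProd x y z e)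

/-- The standard LP with input tensor `G` recovers the ground truth: it has a unique optimal
solution, and this solution is the one given by the ground truth. -/
def SLPRecovers {n m l : ℕ} (x : Fin n → Bool) (y : Fin m → Bool) (z : Fin l → Bool)
    (G : BTensor n m l) : Prop :=
  SLPOptimal G (truthPoint x y z) ∧ ∀ s, SLPOptimal G s → s = truthPoint x y z

/-! The proof builds a random dual certificate. At each entry, the excess of the objective over its
value at the ground truth is at least a linear form in the distances (`gap`) of its three variables
from their true values (`entry_lower_bound`). Its coefficients, `sliceWeight`, depend on the true
bits and on whether the entry was corrupted, not on what the adversary then did. After summation,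
the coefficient of each variable is a sum of independent bounded weights over a slice of the tensor;
if all these sums are positive, recovery follows (`slpRecovers_of_slices_pos`).

The threshold on `p` is what allows a multiplier `lam` making every mean weight positive
(`exists_meanWeight_pos`). Hoeffding's inequality then makes a slice fail with probability
exponentially small in its area, and a union bound over the `n + m + l` slices finishes. -/

/-! ### Concentration and averages over binary vectors. -/

/-- Hoeffding's bound for a weighted count over independent Bernoulli variables: if the expected
average weight is at least `δ`, the total weight is rarely nonpositive. -/
theorem measure_sum_weight_nonpos_le {Ω ι : Type*} [MeasurableSpace Ω] [Fintype ι]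
    (P : Measure Ω) [IsProbabilityMeasure P] (B : ι → Ω → Bool) (hB : ∀ e, Measurable (B e))
    (hind : iIndepFun B P) {p : ℝ} (hp : 0 ≤ p) (hP : ∀ e, P {ω | B e ω = true} = ENNReal.ofReal p)
    (K : ι → Bool → ℝ) (hK : ∀ e b, K e b ∈ Set.Icc (-1 : ℝ) 1) {δ : ℝ} (hδ : 0 ≤ δ)
    (hmean : δ * Fintype.card ι ≤ ∑ e, ((1 - p) * K e false + p * K e true)) :
    P.real {ω | ∑ e, K e (B e ω) ≤ 0} ≤ Real.exp (-(δ ^ 2 * Fintype.card ι / 2)) := by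
  rcases (Fintype.card ι).eq_zero_or_pos with h0 | hpos
  · simp [h0, measureReal_le_one]
  have hmeas : ∀ e, Measurable fun ω => K e (B e ω) := fun e =>
    (measurable_of_finite (K e)).comp (hB e)
  have hint : ∀ e, ∫ ω, K e (B e ω) ∂P = (1 - p) * K e false + p * K e true := by
    intro e
    have hs : MeasurableSet {ω | B e ω = true} := hB e (measurableSet_singleton true)
    have hr : P.real {ω | B e ω = true} = p := by
      rw [measureReal_def, hP, ENNReal.toReal_ofReal hp]
    have heq : (fun ω => K e (B e ω)) = fun ω =>
        K e false + {ω | B e ω = true}.indicator (fun _ => K e true - K e false) ω := by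
      funext ω
      cases h : B e ω <;> simp [Set.indicator, h]
    rw [heq, integral_add (integrable_const _) ((integrable_const _).indicator hs),
      integral_indicator_const _ hs, hr]
    simp
    ring
  have hsub : ∀ e ∈ (Finset.univ : Finset ι), HasSubgaussianMGF
      (fun ω => ((1 - p) * K e false + p * K e true) - K e (B e ω)) 1 P := by
    intro e _
    have h := (hasSubgaussianMGF_of_mem_Icc (μ := P) (hmeas e).aemeasurable
      (Eventually.of_forall fun ω => hK e (B e ω))).neg
    -- Weights in `[-1, 1]` have sub-Gaussian variance proxy 1, whence the exponent `(δN)² / (2N)`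
    -- for `N` entries.
    have h1 : ((‖(1 : ℝ) - (-1)‖₊ / 2) ^ 2 : NNReal) = 1 := by
      ext
      norm_num
    rw [h1, hint] at h
    convert h using 1
    funext ω
    simp
  have hind' : iIndepFun
      (fun e ω => ((1 - p) * K e false + p * K e true) - K e (B e ω)) P :=
    hind.comp (fun e b => ((1 - p) * K e false + p * K e true) - K e b)
      fun e => measurable_of_finite _
  have hmain := HasSubgaussianMGF.measure_sum_ge_le_of_iIndepFun hind' hsub
    (ε := δ * Fintype.card ι) (by positivity)
  refine (measureReal_mono ?_).trans (hmain.trans (le_of_eq ?_))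
  · intro ω hω
    simp only [Set.mem_ofPred_eq, Finset.sum_sub_distrib] at hω ⊢
    linarith
  · congr 1
    have : (Fintype.card ι : ℝ) ≠ 0 := by positivity
    simp
    field_simp

theorem sum_bool_eq {m : ℕ} (hm : 0 < m) (y : Fin m → Bool) {r : ℝ} (hy : density y = r)
    (f : Bool → ℝ) : ∑ j, f (y j) = m * (r * f true + (1 - r) * f false) := by
  have h1 : ∑ j, f (y j) = ∑ j, (f false + if y j = true then f true - f false else 0) := by
    refine Finset.sum_congr rfl fun j _ => ?_
    cases y j <;> simp
  have hm' : (m : ℝ) ≠ 0 := by positivity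
  have hc : ((Finset.univ.filter fun i => y i = true).card : ℝ) = r * m := by
    rw [← hy, density]
    field_simp
  rw [h1, Finset.sum_add_distrib, ← Finset.sum_filter, Finset.sum_const, Finset.sum_const,
    nsmul_eq_mul, nsmul_eq_mul, hc]
  simp
  ring

theorem density_le_one {m : ℕ} (y : Fin m → Bool) : density y ≤ 1 := by
  refine div_le_one_of_le₀ ?_ (Nat.cast_nonneg _)
  exact_mod_cast (Finset.card_filter_le _ _).trans (by simp)

/-! ### The entrywise certificate. -/

/-- The share of the entry `(b, b', b'')` of the ground truth in the coefficient of the first of its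
three variables, in a linear lower bound for the objective of the standard LP; `c` says whether the
entry is corrupted. -/
noncomputable def sliceWeight (lam : ℝ) : Bool → Bool → Bool → Bool → ℝ
  | true, true, true, false => 1 / 3
  | true, true, true, true => -1
  | true, true, false, false => -lam
  | true, false, true, false => -lam
  | false, true, true, false => lam
  | false, true, true, true => -1
  | false, true, false, true => -(1 / 2)
  | false, false, true, true => -(1 / 2)
  | false, false, false, true => -(1 / 3)
  | _, _, _, _ => 0

theorem sliceWeight_mem_Icc {lam : ℝ} (h0 : 0 ≤ lam) (h1 : lam ≤ 1) (b b' b'' c : Bool) :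
    sliceWeight lam b b' b'' c ∈ Set.Icc (-1 : ℝ) 1 := by
  cases b <;> cases b' <;> cases b'' <;> cases c <;> simp only [sliceWeight, Set.mem_Icc] <;>
    constructor <;> linarith

/-- The distance of a number in `[0, 1]` to a binary value. -/
noncomputable def gap (b : Bool) (X : ℝ) : ℝ := if b then 1 - X else X

/-- An uncorrupted 1 averages the three bounds on `w`. An uncorrupted 0 with two true bits mixes `X
+ Y + Z - 2 ≤ w` and `0 ≤ w` with weights `lam` and `1 - lam`. The weights for `c = true` are valid
for both values of `g`, so reverting a corruption does no harm. -/
theorem entry_lower_bound {lam : ℝ} (h0 : 0 ≤ lam) (h1 : lam ≤ 1) (bx bv bz g c : Bool)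
    (hc : c = false → g = (bx && bv && bz)) {X Y Z w : ℝ} (hX : X ∈ Set.Icc (0 : ℝ) 1)
    (hY : Y ∈ Set.Icc (0 : ℝ) 1) (hZ : Z ∈ Set.Icc (0 : ℝ) 1)
    (hwX : g = true → w ≤ X) (hwY : g = true → w ≤ Y) (hwZ : g = true → w ≤ Z)
    (hw0 : g = false → 0 ≤ w) (hw : g = false → X + Y + Z - 2 ≤ w) :
    sliceWeight lam bx bv bz c * gap bx X + sliceWeight lam bv bx bz c * gap bv Y +
      sliceWeight lam bz bx bv c * gap bz Z ≤
      if g then bit01 (bx && bv && bz) - w else w - bit01 (bx && bv && bz) := by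
  obtain ⟨hX0, hX1⟩ := hX
  obtain ⟨hY0, hY1⟩ := hY
  obtain ⟨hZ0, hZ1⟩ := hZ
  cases g
  · have a1 := hw0 rfl
    have a2 := mul_nonneg h0 (sub_nonneg.2 (hw rfl))
    have a3 := mul_nonneg (sub_nonneg.2 h1) a1
    have a4 := hw rfl
    clear hwX hwY hwZ hw0 hw
    cases bx <;> cases bv <;> cases bz <;> cases c <;>
      simp [sliceWeight, gap, bit01] at hc ⊢ <;> nlinarith
  · have a1 := hwX rfl
    have a2 := hwY rfl
    have a3 := hwZ rfl
    clear hwX hwY hwZ hw0 hw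
    cases bx <;> cases bv <;> cases bz <;> cases c <;>
      simp [sliceWeight, gap, bit01] at hc ⊢ <;> linarith

/-! ### Mean weights and the threshold. -/

/-- The expected average weight of a slice through a coordinate of truth value `b`. -/
noncomputable def meanWeight (lam p r : ℝ) (b : Bool) : ℝ :=
  r * (r * ((1 - p) * sliceWeight lam b true true false + p * sliceWeight lam b true true true) +
    (1 - r) *
      ((1 - p) * sliceWeight lam b true false false + p * sliceWeight lam b true false true)) +
  (1 - r) * (r * ((1 - p) * sliceWeight lam b false true false +
      p * sliceWeight lam b false true true) +
    (1 - r) *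
      ((1 - p) * sliceWeight lam b false false false + p * sliceWeight lam b false false true))

/-- With `κ = (1 - p) * lam`, the two means are positive iff `6 * (1 - r) * κ < r * (1 - 4 * p)` and
`p * (1 + r + r ^ 2) < 3 * r ^ 2 * κ`. Eliminating `κ` leaves exactly `2 * p * (1 + r ^ 3) < r ^ 3`.
-/
theorem exists_meanWeight_pos {r p : ℝ} (hr : 0 < r) (hr1 : r ≤ 1) (hp0 : 0 ≤ p)
    (hp : p < r ^ 3 / (2 * (1 + r ^ 3))) :
    ∃ lam δ : ℝ, 0 ≤ lam ∧ lam ≤ 1 ∧ 0 < δ ∧ ∀ b, δ ≤ meanWeight lam p r b := by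
  have hr3 : 0 < r ^ 3 := by positivity
  have hs : 0 < r ^ 3 - 2 * p * (1 + r ^ 3) := by
    rw [lt_div_iff₀ (by positivity)] at hp
    linarith
  have hr2 : r ^ 2 ≤ 1 := pow_le_one₀ hr.le hr1
  have hr31 : r ^ 3 ≤ 1 := pow_le_one₀ hr.le hr1
  have hr32 : r ^ 3 ≤ r ^ 2 := pow_le_pow_of_le_one hr.le hr1 (by norm_num)
  have hr42 : r ^ 4 ≤ r ^ 2 := pow_le_pow_of_le_one hr.le hr1 (by norm_num)
  have hp4 : p < 1 / 4 := by nlinarith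
  have hp3 : 2 * p ≤ r ^ 3 := by nlinarith [mul_nonneg hp0 hr3.le]
  -- The lower bound on `κ` plus a quarter of the slack; this leaves room in the upper bound.
  obtain ⟨κ, hκ⟩ : ∃ κ, 3 * r ^ 2 * κ =
      p * (1 + r + r ^ 2) + (r ^ 3 - 2 * p * (1 + r ^ 3)) / 4 :=
    ⟨(p * (1 + r + r ^ 2) + (r ^ 3 - 2 * p * (1 + r ^ 3)) / 4) / (3 * r ^ 2), by field_simp⟩
  have hr2pos : 0 < r ^ 2 := by positivity
  have hκ0 : 0 ≤ κ := by
    have : 0 ≤ 3 * r ^ 2 * κ := by rw [hκ]; positivity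
    exact nonneg_of_mul_nonneg_right this (by positivity)
  have hκ1 : κ ≤ 1 - p := by
    have h1 : 3 * r ^ 2 * κ ≤ 3 * r ^ 2 * (1 - p) := by
      rw [hκ]
      nlinarith [mul_nonneg hp0 hr3.le, mul_le_mul_of_nonneg_right hp3 hr.le,
        mul_le_mul_of_nonneg_right hp4.le hr2pos.le]
    exact le_of_mul_le_mul_left h1 (by positivity)
  have hq : 0 < 1 - p := by linarith
  have hlam : (1 - p) * (κ / (1 - p)) = κ := by field_simp
  have m1 : 0 < meanWeight (κ / (1 - p)) p r true := by
    have : meanWeight (κ / (1 - p)) p r true =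
        r ^ 2 * (1 - 4 * p) / 3 - 2 * r * (1 - r) * ((1 - p) * (κ / (1 - p))) := by
      simp only [meanWeight, sliceWeight]
      ring
    rw [this, hlam]
    have h3 : 3 * r * (r ^ 2 * (1 - 4 * p) / 3 - 2 * r * (1 - r) * κ) =
        (r ^ 3 - 2 * p * (1 + r ^ 3)) * (1 + r) / 2 := by
      linear_combination (-2) * (1 - r) * hκ
    have h4 : 0 < 3 * r * (r ^ 2 * (1 - 4 * p) / 3 - 2 * r * (1 - r) * κ) := by
      rw [h3]
      positivity
    exact pos_of_mul_pos_right h4 (by positivity)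
  have m0 : 0 < meanWeight (κ / (1 - p)) p r false := by
    have : meanWeight (κ / (1 - p)) p r false =
        r ^ 2 * ((1 - p) * (κ / (1 - p)) - p) - p * r * (1 - r) - p * (1 - r) ^ 2 / 3 := by
      simp only [meanWeight, sliceWeight]
      ring
    rw [this, hlam]
    nlinarith
  refine ⟨κ / (1 - p), min (meanWeight (κ / (1 - p)) p r true)
    (meanWeight (κ / (1 - p)) p r false), by positivity, div_le_one_of_le₀ hκ1 hq.le,
    lt_min m1 m0, ?_⟩
  rintro (_ | _)
  · exact min_le_right _ _
  · exact min_le_left _ _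

theorem sum_slice_mean {m l : ℕ} (hm : 0 < m) (hl : 0 < l) (y : Fin m → Bool) (z : Fin l → Bool)
    {r : ℝ} (hy : density y = r) (hz : density z = r) (lam p : ℝ) (b : Bool) :
    ∑ e : Fin m × Fin l, ((1 - p) * sliceWeight lam b (y e.1) (z e.2) false +
      p * sliceWeight lam b (y e.1) (z e.2) true) =
    meanWeight lam p r b * Fintype.card (Fin m × Fin l) := by
  rw [Fintype.sum_prod_type]
  have hrow := fun s => sum_bool_eq hl z hz fun t =>
    (1 - p) * sliceWeight lam b s t false + p * sliceWeight lam b s t true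
  simp only [hrow]
  rw [sum_bool_eq hm y hy fun s => (l : ℝ) *
    (r * ((1 - p) * sliceWeight lam b s true false + p * sliceWeight lam b s true true) +
    (1 - r) * ((1 - p) * sliceWeight lam b s false false + p * sliceWeight lam b s false true))]
  simp only [Fintype.card_prod, Fintype.card_fin, Nat.cast_mul, meanWeight]
  ring

/-! ### From positive slices to unique optimality. -/

theorem bit01_mem_Icc (b : Bool) : bit01 b ∈ Set.Icc (0 : ℝ) 1 := by
  cases b <;> simp [bit01]

theorem gap_nonneg (b : Bool) {X : ℝ} (hX : X ∈ Set.Icc (0 : ℝ) 1) : 0 ≤ gap b X := by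
  cases b <;> simp [gap, hX.1, hX.2]

theorem eq_bit01_of_gap_eq_zero {b : Bool} {X : ℝ} (h : gap b X = 0) : X = bit01 b := by
  cases b <;> simp [gap, bit01] at h ⊢ <;> linarith

theorem truthPoint_feasible {n m l : ℕ} (x : Fin n → Bool) (y : Fin m → Bool) (z : Fin l → Bool)
    (G : BTensor n m l) : SLPFeasible G (truthPoint x y z) where
  le_x i j k _ := by
    cases hx : x i <;> cases hy : y j <;> cases hz : z k <;>
      simp [truthPoint, outerProd, bit01, hx, hy, hz]
  le_y i j k _ := by
    cases hx : x i <;> cases hy : y j <;> cases hz : z k <;>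
      simp [truthPoint, outerProd, bit01, hx, hy, hz]
  le_z i j k _ := by
    cases hx : x i <;> cases hy : y j <;> cases hz : z k <;>
      simp [truthPoint, outerProd, bit01, hx, hy, hz]
  nonneg i j k _ := (bit01_mem_Icc _).1
  sum_le i j k _ := by
    cases hx : x i <;> cases hy : y j <;> cases hz : z k <;>
      simp [truthPoint, outerProd, bit01, hx, hy, hz] <;> norm_num
  mem_x i := bit01_mem_Icc _
  mem_y j := bit01_mem_Icc _
  mem_z k := bit01_mem_Icc _

theorem slpObjective_eq_sum {n m l : ℕ} (G : BTensor n m l) (s : LPPoint n m l) :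
    slpObjective G s = ∑ e, if G e then 1 - s.w e else s.w e := by
  rw [slpObjective, Finset.sum_filter, Finset.sum_filter, ← Finset.sum_add_distrib]
  refine Finset.sum_congr rfl fun e _ => ?_
  cases G e <;> simp

theorem sum_coords_eq_slices {n m l : ℕ} (f g h : Fin n × Fin m × Fin l → ℝ)
    (a : Fin n → ℝ) (b : Fin m → ℝ) (c : Fin l → ℝ) :
    ∑ e, (f e * a e.1 + g e * b e.2.1 + h e * c e.2.2) =
      ∑ i, (∑ e : Fin m × Fin l, f (i, e.1, e.2)) * a i +
      ∑ j, (∑ e : Fin n × Fin l, g (e.1, j, e.2)) * b j +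
      ∑ k, (∑ e : Fin n × Fin m, h (e.1, e.2, k)) * c k := by
  simp only [Finset.sum_add_distrib, Finset.sum_mul, Fintype.sum_prod_type]
  congr 1
  · congr 1
    exact Finset.sum_comm
  · exact (Finset.sum_comm.trans (Finset.sum_congr rfl fun i _ => Finset.sum_comm)).symm

/-- If the linear lower bound of the objective has positive coefficients, for a set `C` of entries
off which the input agrees with the ground truth, then the standard LP recovers the ground truth. -/
theorem slpRecovers_of_slices_pos {n m l : ℕ} (x : Fin n → Bool) (y : Fin m → Bool)
    (z : Fin l → Bool) (G C : BTensor n m l) {lam : ℝ} (h0 : 0 ≤ lam) (h1 : lam ≤ 1)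
    (hC : ∀ e, C e = false → G e = outerProd x y z e)
    (hx : ∀ i, 0 < ∑ e : Fin m × Fin l, sliceWeight lam (x i) (y e.1) (z e.2) (C (i, e.1, e.2)))
    (hy : ∀ j, 0 < ∑ e : Fin n × Fin l, sliceWeight lam (y j) (x e.1) (z e.2) (C (e.1, j, e.2)))
    (hz : ∀ k, 0 < ∑ e : Fin n × Fin m, sliceWeight lam (z k) (x e.1) (y e.2) (C (e.1, e.2, k))) :
    SLPRecovers x y z G := by
  have hentry : ∀ s, SLPFeasible G s → ∀ e,
      sliceWeight lam (x e.1) (y e.2.1) (z e.2.2) (C e) * gap (x e.1) (s.x e.1) +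
      sliceWeight lam (y e.2.1) (x e.1) (z e.2.2) (C e) * gap (y e.2.1) (s.y e.2.1) +
      sliceWeight lam (z e.2.2) (x e.1) (y e.2.1) (C e) * gap (z e.2.2) (s.z e.2.2) ≤
      if G e then bit01 (outerProd x y z e) - s.w e else s.w e - bit01 (outerProd x y z e) :=
    fun s hs ⟨i, j, k⟩ => entry_lower_bound h0 h1 _ _ _ _ _ (hC (i, j, k)) (hs.mem_x i)
      (hs.mem_y j) (hs.mem_z k) (hs.le_x i j k) (hs.le_y i j k) (hs.le_z i j k)
      (hs.nonneg i j k) (hs.sum_le i j k)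
  have hdiff : ∀ s, slpObjective G s - slpObjective G (truthPoint x y z) = ∑ e,
      if G e then bit01 (outerProd x y z e) - s.w e else s.w e - bit01 (outerProd x y z e) := by
    intro s
    rw [slpObjective_eq_sum, slpObjective_eq_sum, ← Finset.sum_sub_distrib]
    refine Finset.sum_congr rfl fun e _ => ?_
    cases G e <;> simp [truthPoint]
  have hbound : ∀ s, SLPFeasible G s →
      ∑ i, (∑ e : Fin m × Fin l, sliceWeight lam (x i) (y e.1) (z e.2) (C (i, e.1, e.2))) *
        gap (x i) (s.x i) +
      ∑ j, (∑ e : Fin n × Fin l, sliceWeight lam (y j) (x e.1) (z e.2) (C (e.1, j, e.2))) *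
        gap (y j) (s.y j) +
      ∑ k, (∑ e : Fin n × Fin m, sliceWeight lam (z k) (x e.1) (y e.2) (C (e.1, e.2, k))) *
        gap (z k) (s.z k) ≤ slpObjective G s - slpObjective G (truthPoint x y z) := by
    intro s hs
    rw [hdiff, ← sum_coords_eq_slices
      (fun e => sliceWeight lam (x e.1) (y e.2.1) (z e.2.2) (C e))
      (fun e => sliceWeight lam (y e.2.1) (x e.1) (z e.2.2) (C e))
      (fun e => sliceWeight lam (z e.2.2) (x e.1) (y e.2.1) (C e))
      (fun i => gap (x i) (s.x i)) (fun j => gap (y j) (s.y j)) (fun k => gap (z k) (s.z k))]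
    exact Finset.sum_le_sum fun e _ => hentry s hs e
  have px : ∀ s, SLPFeasible G s → ∀ i ∈ Finset.univ, 0 ≤
      (∑ e : Fin m × Fin l, sliceWeight lam (x i) (y e.1) (z e.2) (C (i, e.1, e.2))) *
        gap (x i) (s.x i) :=
    fun s hs i _ => mul_nonneg (hx i).le (gap_nonneg _ (hs.mem_x i))
  have py : ∀ s, SLPFeasible G s → ∀ j ∈ Finset.univ, 0 ≤
      (∑ e : Fin n × Fin l, sliceWeight lam (y j) (x e.1) (z e.2) (C (e.1, j, e.2))) *
        gap (y j) (s.y j) :=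
    fun s hs j _ => mul_nonneg (hy j).le (gap_nonneg _ (hs.mem_y j))
  have pz : ∀ s, SLPFeasible G s → ∀ k ∈ Finset.univ, 0 ≤
      (∑ e : Fin n × Fin m, sliceWeight lam (z k) (x e.1) (y e.2) (C (e.1, e.2, k))) *
        gap (z k) (s.z k) :=
    fun s hs k _ => mul_nonneg (hz k).le (gap_nonneg _ (hs.mem_z k))
  have hfeas := truthPoint_feasible x y z G
  refine ⟨⟨hfeas, fun s hs => ?_⟩, fun s ⟨hs, hopt⟩ => ?_⟩
  · have := hbound s hs
    have := Finset.sum_nonneg (px s hs)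
    have := Finset.sum_nonneg (py s hs)
    have := Finset.sum_nonneg (pz s hs)
    linarith
  · have h := hbound s hs
    have ho := hopt _ hfeas
    have sx := Finset.sum_nonneg (px s hs)
    have sy := Finset.sum_nonneg (py s hs)
    have sz := Finset.sum_nonneg (pz s hs)
    have gx : ∀ i, gap (x i) (s.x i) = 0 := fun i =>
      (mul_eq_zero.1 ((Finset.sum_eq_zero_iff_of_nonneg (px s hs)).1 (by linarith) i
        (Finset.mem_univ i))).resolve_left (hx i).ne'
    have gy : ∀ j, gap (y j) (s.y j) = 0 := fun j =>
      (mul_eq_zero.1 ((Finset.sum_eq_zero_iff_of_nonneg (py s hs)).1 (by linarith) j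
        (Finset.mem_univ j))).resolve_left (hy j).ne'
    have gz : ∀ k, gap (z k) (s.z k) = 0 := fun k =>
      (mul_eq_zero.1 ((Finset.sum_eq_zero_iff_of_nonneg (pz s hs)).1 (by linarith) k
        (Finset.mem_univ k))).resolve_left (hz k).ne'
    -- The gaps do not control `w`. Once they vanish, each entry's excess is nonnegative while the
    -- total is at most 0, so each is 0.
    have hnn : ∀ e ∈ Finset.univ, 0 ≤
        if G e then bit01 (outerProd x y z e) - s.w e else s.w e - bit01 (outerProd x y z e) := by
      intro e _
      simpa [gx, gy, gz] using hentry s hs e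
    have hzero := (Finset.sum_eq_zero_iff_of_nonneg hnn).1
      (le_antisymm (by rw [← hdiff]; linarith) (Finset.sum_nonneg hnn))
    ext e
    · exact eq_bit01_of_gap_eq_zero (gx e)
    · exact eq_bit01_of_gap_eq_zero (gy e)
    · exact eq_bit01_of_gap_eq_zero (gz e)
    · have := hzero e (Finset.mem_univ e)
      change s.w e = bit01 (outerProd x y z e)
      split_ifs at this <;> linarith

/-! ### The adversary and the union bound. -/

theorem MonotoneStep.reflTransGen_eq_or_eq {n m l : ℕ} {W G₀ G : BTensor n m l}
    (h : Relation.ReflTransGen (MonotoneStep W) G₀ G) (e : Fin n × Fin m × Fin l) :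
    G e = G₀ e ∨ G e = W e := by
  induction h with
  | refl => exact Or.inl rfl
  | tail _ hs ih =>
    cases hs with
    | revertToOne e' hW hG =>
      by_cases he : e = e'
      · subst he
        simp [hW]
      · simpa [Function.update_of_ne he] using ih
    | revertToZero e' hW hG =>
      by_cases he : e = e'
      · subst he
        simp [hW]
      · simpa [Function.update_of_ne he] using ih

theorem le_measure_slpRecovers {n m l : ℕ} (hn : 0 < n) (hm : 0 < m) (hl : 0 < l)
    (x : Fin n → Bool) (y : Fin m → Bool) (z : Fin l → Bool) {r p lam δ : ℝ}
    (hx : density x = r) (hy : density y = r) (hz : density z = r) (hp : 0 ≤ p)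
    (h0 : 0 ≤ lam) (h1 : lam ≤ 1) (hδ : 0 ≤ δ) (hmean : ∀ b, δ ≤ meanWeight lam p r b)
    {Ω : Type*} [MeasurableSpace Ω] (P : Measure Ω) [IsProbabilityMeasure P]
    (G : Ω → BTensor n m l) (hG : IsSemiRandom P (outerProd x y z) p G) :
    1 - (n * Real.exp (-(δ ^ 2 * (m * l) / 2)) + m * Real.exp (-(δ ^ 2 * (n * l) / 2)) +
      l * Real.exp (-(δ ^ 2 * (n * m) / 2))) ≤ P.real {ω | SLPRecovers x y z (G ω)} := by
  obtain ⟨-, G₀, hG₀, hstep⟩ := hG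
  -- Corruption is read off `G₀`, before the adversary acts, so independence is preserved.
  let C : Fin n × Fin m × Fin l → Ω → Bool := fun e ω => (G₀ ω e).xor (outerProd x y z e)
  have hCmeas : ∀ e, Measurable (C e) := fun e =>
    (measurable_of_finite fun b : Bool => b.xor (outerProd x y z e)).comp
      ((measurable_pi_apply e).comp hG₀.measurable)
  have hCind : iIndepFun C P :=
    hG₀.indep.comp (fun e b => b.xor (outerProd x y z e)) fun e => measurable_of_finite _
  have hCP : ∀ e, P {ω | C e ω = true} = ENNReal.ofReal p := by
    intro e
    rw [← hG₀.corrupted e]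
    congr 1
    ext ω
    change (G₀ ω e).xor (outerProd x y z e) = true ↔ G₀ ω e = !(outerProd x y z e)
    cases G₀ ω e <;> cases outerProd x y z e <;> simp
  have tail : ∀ {a b : ℕ} (ha : 0 < a) (hb : 0 < b) (u : Fin a → Bool) (v : Fin b → Bool)
      (_ : density u = r) (_ : density v = r) (f : Fin a × Fin b → Fin n × Fin m × Fin l)
      (_ : f.Injective) (t : Bool),
      P.real {ω | ∑ e : Fin a × Fin b, sliceWeight lam t (u e.1) (v e.2) (C (f e) ω) ≤ 0} ≤
        Real.exp (-(δ ^ 2 * (a * b) / 2)) := by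
    intro a b ha hb u v hu hv f hf t
    have h := measure_sum_weight_nonpos_le P (fun e => C (f e)) (fun e => hCmeas (f e))
      (hCind.precomp hf) hp (fun e => hCP (f e))
      (fun e c => sliceWeight lam t (u e.1) (v e.2) c)
      (fun e c => sliceWeight_mem_Icc h0 h1 _ _ _ _) hδ
      (by
        rw [sum_slice_mean ha hb u v hu hv]
        exact mul_le_mul_of_nonneg_right (hmean t) (Nat.cast_nonneg _))
    simpa using h
  let Ax : Fin n → Set Ω := fun i => {ω | ∑ e : Fin m × Fin l,
    sliceWeight lam (x i) (y e.1) (z e.2) (C (i, e.1, e.2) ω) ≤ 0}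
  let Ay : Fin m → Set Ω := fun j => {ω | ∑ e : Fin n × Fin l,
    sliceWeight lam (y j) (x e.1) (z e.2) (C (e.1, j, e.2) ω) ≤ 0}
  let Az : Fin l → Set Ω := fun k => {ω | ∑ e : Fin n × Fin m,
    sliceWeight lam (z k) (x e.1) (y e.2) (C (e.1, e.2, k) ω) ≤ 0}
  have bx : P.real (⋃ i, Ax i) ≤ n * Real.exp (-(δ ^ 2 * (m * l) / 2)) := by
    refine (measureReal_iUnion_fintype_le _).trans ?_
    refine (Finset.sum_le_card_nsmul _ _ _ fun i _ => tail hm hl y z hy hz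
      (fun e => (i, e.1, e.2)) (fun e e' h => by simpa [Prod.ext_iff] using h) (x i)).trans ?_
    simp
  have bv : P.real (⋃ j, Ay j) ≤ m * Real.exp (-(δ ^ 2 * (n * l) / 2)) := by
    refine (measureReal_iUnion_fintype_le _).trans ?_
    refine (Finset.sum_le_card_nsmul _ _ _ fun j _ => tail hn hl x z hx hz
      (fun e => (e.1, j, e.2)) (fun e e' h => by simpa [Prod.ext_iff] using h) (y j)).trans ?_
    simp
  have bz : P.real (⋃ k, Az k) ≤ l * Real.exp (-(δ ^ 2 * (n * m) / 2)) := by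
    refine (measureReal_iUnion_fintype_le _).trans ?_
    refine (Finset.sum_le_card_nsmul _ _ _ fun k _ => tail hn hm x y hx hy
      (fun e => (e.1, e.2, k)) (fun e e' h => by simpa [Prod.ext_iff] using h) (z k)).trans ?_
    simp
  -- Covering the whole space uses only subadditivity, so the recovery event need not be shown
  -- measurable.
  have hcover : (Set.univ : Set Ω) ⊆
      (((⋃ i, Ax i) ∪ ⋃ j, Ay j) ∪ ⋃ k, Az k) ∪ {ω | SLPRecovers x y z (G ω)} := by
    intro ω _
    by_contra hω
    simp only [Set.mem_union, Set.mem_iUnion, not_or, not_exists] at hω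
    obtain ⟨⟨⟨ax, ay⟩, az⟩, hrec⟩ := hω
    refine hrec (slpRecovers_of_slices_pos x y z (G ω) (fun e => C e ω) h0 h1 (fun e he => ?_)
      (fun i => not_le.1 (ax i)) (fun j => not_le.1 (ay j)) fun k => not_le.1 (az k))
    rcases MonotoneStep.reflTransGen_eq_or_eq (hstep ω) e with h | h
    · rw [h]
      simpa [C] using he
    · exact h
  have hone : (1 : ℝ) ≤ P.real
      ((((⋃ i, Ax i) ∪ ⋃ j, Ay j) ∪ ⋃ k, Az k) ∪ {ω | SLPRecovers x y z (G ω)}) := by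
    rw [← probReal_univ (μ := P)]
    exact measureReal_mono hcover
  have u1 := measureReal_union_le (μ := P) (((⋃ i, Ax i) ∪ ⋃ j, Ay j) ∪ ⋃ k, Az k)
    {ω | SLPRecovers x y z (G ω)}
  have u2 := measureReal_union_le (μ := P) ((⋃ i, Ax i) ∪ ⋃ j, Ay j) (⋃ k, Az k)
  have u3 := measureReal_union_le (μ := P) (⋃ i, Ax i) (⋃ j, Ay j)
  linarith

/-! ### Passage to the limit. -/

/-- As soon as `c t ≥ 2 / κ`, the exponent `κ * (b t * c t) / 2` is at least `b t`: the second slice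
dimension absorbs the constant. -/
theorem tendsto_mul_exp_neg_mul_mul {a b c : ℕ → ℕ} {κ : ℝ} (hκ : 0 < κ)
    (hc : Tendsto c atTop atTop)
    (h : Tendsto (fun t => (a t : ℝ) * Real.exp (-(b t : ℝ))) atTop (𝓝 0)) :
    Tendsto (fun t => (a t : ℝ) * Real.exp (-(κ * (b t * c t) / 2))) atTop (𝓝 0) := by
  refine tendsto_of_tendsto_of_tendsto_of_le_of_le' tendsto_const_nhds h
    (Eventually.of_forall fun t => by positivity) ?_
  have hc' : Tendsto (fun t => (c t : ℝ)) atTop atTop := tendsto_natCast_atTop_atTop.comp hc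
  filter_upwards [hc'.eventually_ge_atTop (2 / κ)] with t ht
  rw [div_le_iff₀ hκ] at ht
  refine mul_le_mul_of_nonneg_left (Real.exp_le_exp.2 ?_) (Nat.cast_nonneg _)
  nlinarith [mul_le_mul_of_nonneg_left ht (Nat.cast_nonneg (α := ℝ) (b t))]

theorem pos_of_density_pos {n : ℕ} {x : Fin n → Bool} (h : 0 < density x) : 0 < n := by
  rcases n.eq_zero_or_pos with rfl | hn
  · simp [density] at h
  · exact hn

theorem mainTheorem4
    (rx ry rz rw p : ℝ) (hrx : 0 < rx) (hry : 0 < ry) (hrz : 0 < rz)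
    (hxy : rx = ry) (hyz : ry = rz) (hrw : rw = rx * ry * rz)
    (hp0 : 0 ≤ p) (hp : p < rw / (2 * (1 + rw)))
    (n m l : ℕ → ℕ)
    (hn : Tendsto n atTop atTop) (hm : Tendsto m atTop atTop) (hl : Tendsto l atTop atTop)
    (hnm : Tendsto (fun t => (n t : ℝ) * Real.exp (-(m t : ℝ))) atTop (𝓝 0))
    (hnl : Tendsto (fun t => (n t : ℝ) * Real.exp (-(l t : ℝ))) atTop (𝓝 0))
    (hmn : Tendsto (fun t => (m t : ℝ) * Real.exp (-(n t : ℝ))) atTop (𝓝 0))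
    (hml : Tendsto (fun t => (m t : ℝ) * Real.exp (-(l t : ℝ))) atTop (𝓝 0))
    (hln : Tendsto (fun t => (l t : ℝ) * Real.exp (-(n t : ℝ))) atTop (𝓝 0))
    (hlm : Tendsto (fun t => (l t : ℝ) * Real.exp (-(m t : ℝ))) atTop (𝓝 0))
    (x : ∀ t, Fin (n t) → Bool) (y : ∀ t, Fin (m t) → Bool) (z : ∀ t, Fin (l t) → Bool)
    (hx : ∀ t, density (x t) = rx) (hy : ∀ t, density (y t) = ry)
    (hz : ∀ t, density (z t) = rz)
    (Ω : ℕ → Type*) [∀ t, MeasurableSpace (Ω t)]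
    (P : ∀ t, Measure (Ω t)) [∀ t, IsProbabilityMeasure (P t)]
    (G : ∀ t, Ω t → BTensor (n t) (m t) (l t))
    (hG : ∀ t, IsSemiRandom (P t) (outerProd (x t) (y t) (z t)) p (G t)) :
    Tendsto (fun t => P t {ω | SLPRecovers (x t) (y t) (z t) (G t ω)}) atTop (𝓝 1) := by
  subst hxy hyz hrw
  have hr1 : rx ≤ 1 := hx 0 ▸ density_le_one (x 0)
  obtain ⟨lam, δ, h0, h1, hδ, hmean⟩ := exists_meanWeight_pos hrx hr1 hp0
    (by simpa only [pow_succ, pow_zero, one_mul] using hp)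
  have hδ2 : 0 < δ ^ 2 := by positivity
  have e1 := tendsto_mul_exp_neg_mul_mul hδ2 hl hnm
  have e2 := tendsto_mul_exp_neg_mul_mul hδ2 hl hmn
  have e3 := tendsto_mul_exp_neg_mul_mul hδ2 hm hln
  have hlim := ENNReal.tendsto_ofReal (((e1.add e2).add e3).const_sub 1)
  simp only [add_zero, sub_zero, ENNReal.ofReal_one] at hlim
  refine tendsto_of_tendsto_of_tendsto_of_le_of_le hlim tendsto_const_nhds (fun t => ?_)
    fun t => prob_le_one
  have h := le_measure_slpRecovers (pos_of_density_pos (hx t ▸ hrx))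
    (pos_of_density_pos (hy t ▸ hrx)) (pos_of_density_pos (hz t ▸ hrx)) (x t) (y t) (z t)
    (hx t) (hy t) (hz t) hp0 h0 h1 hδ.le hmean (P t) (G t) (hG t)
  exact (ENNReal.ofReal_le_ofReal h).trans (ENNReal.ofReal_le_of_le_toReal le_rfl)
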